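/- Let $K$ be a field of characteristic $\neq 2,3$ and let $\gamma\in K$ with $\gamma\neq 0,\pm1,\pm\frac12$. All algebras are nonassociative (not necessarily associative) and need not have a unit. For an element $x$ of a commutative $K$-algebra $A$ let $L_x\colon A\to A$, $L_x(a)=xa$, and $x^3=x(xx)$. An algebra is nilpotent if for some $m\ge 1$ every product of $m$ of its elements, however bracketed, is zero; the least such $m$ is its index of nilpotency. An algebra is locally nilpotent if each of its finitely generated subalgebras is nilpotent. (a) Every commutative $K$-algebra satisfying the identity $L_x^3+\gamma L_{x^3}=0$ is locally nilpotent. (b) More precisely, let $k\ge 1$. The free commutative $K$-algebra on $k$ generators satisfying the identity $x^3=0$ is nilpotent; let $n$ be its index of nilpotency. Let $\dim[n,k]$ be the dimension of the subspace of the free commutative $K$-algebra on $k$ generators that is spanned by the monomials of degree less than $n$. Then every commutative $K$-algebra that is generated by $k$ elements and satisfies $L_x^3+\gamma L_{x^3}=0$ is nilpotent of index at most $$2^{\,4n\dim[n,k]+2(n-2)}.$$ -/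

import Mathlib

universe u v

/-! ### Nilpotency of nonassociative algebras -/

/-- `ProductsVanish A n`: every product of `n` elements of `A`, with any arrangement of the
brackets, is zero. A bracketed product of elements of `A` is an element `w` of the free magma
on `A`, the number of its factors is `w.length`, and its value is `FreeMagma.lift id w`. -/
def ProductsVanish (A : Type v) [NonUnitalNonAssocRing A] (n : ℕ) : Prop :=
  ∀ w : FreeMagma A, w.length = n → FreeMagma.lift (id : A → A) w = 0

/-- `n` is the index of nilpotency of `A`: the least positive integer such that every product
of `n` elements of `A`, however bracketed, is zero. -/
def HasNilpotencyIndex (A : Type v) [NonUnitalNonAssocRing A] (n : ℕ) : Prop :=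
  IsLeast {m : ℕ | 0 < m ∧ ProductsVanish A m} n

/-- `A` is nilpotent: for some `n ≥ 1` all products of `n` elements vanish. -/
def IsNilpotentAlgebra (A : Type v) [NonUnitalNonAssocRing A] : Prop :=
  ∃ n : ℕ, 0 < n ∧ ProductsVanish A n

section

variable (K : Type u) [Field K] (A : Type v) [NonUnitalNonAssocCommRing A] [Module K A]
  [IsScalarTower K A A] [SMulCommClass K A A]

/-- `A` is locally nilpotent: every finitely generated subalgebra of `A` is nilpotent. -/
def IsLocallyNilpotentAlgebra : Prop :=
  ∀ s : Finset A, IsNilpotentAlgebra (NonUnitalAlgebra.adjoin K (s : Set A))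

/-- The algebra `A` is generated by `k` elements (not necessarily distinct). -/
def IsGeneratedBy (k : ℕ) : Prop :=
  ∃ g : Fin k → A, NonUnitalAlgebra.adjoin K (Set.range g) = ⊤

/-- The identity `L_x ^ 3 + γ L_{x ^ 3} = 0`, where `L_x` is the multiplication by `x` and
`x ^ 3 = x (x x)`. -/
def SatisfiesCubicIdentity (γ : K) : Prop :=
  ∀ x : A, LinearMap.mulLeft K x ∘ₗ LinearMap.mulLeft K x ∘ₗ LinearMap.mulLeft K x
    + γ • LinearMap.mulLeft K (x * (x * x)) = 0

end

/-! ### The free commutative algebra -/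

/-- The congruence on the free magma generated by `a b ~ b a`. -/
def commCon (X : Type u) : Con (FreeMagma X) :=
  conGen fun p q => ∃ a b : FreeMagma X, p = a * b ∧ q = b * a

/-- The commutative nonassociative monomials in the letters `X`. -/
abbrev CommMonomial (X : Type u) : Type u := (commCon X).Quotient

theorem commMonomial_mul_comm {X : Type u} (p q : CommMonomial X) : p * q = q * p := by
  induction p, q using Con.induction_on₂ with
  | H a b =>
    exact (Con.eq (commCon X)).2 (ConGen.Rel.of _ _ ⟨a, b, rfl, rfl⟩)

theorem length_eq_of_commCon {X : Type u} (a b : FreeMagma X) (h : commCon X a b) :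
    a.length = b.length := by
  change ConGen.Rel (fun p q => ∃ a b : FreeMagma X, p = a * b ∧ q = b * a) a b at h
  induction h with
  | of p q hpq =>
    obtain ⟨a, b, rfl, rfl⟩ := hpq
    exact Nat.add_comm _ _
  | refl => rfl
  | symm h ih => exact ih.symm
  | trans h1 h2 ih1 ih2 => exact ih1.trans ih2
  | mul h1 h2 ih1 ih2 => exact congrArg₂ (· + ·) ih1 ih2

/-- The degree of a commutative monomial: the number of its letters, with multiplicity. -/
def CommMonomial.degree {X : Type u} (p : CommMonomial X) : ℕ :=
  Con.liftOn p FreeMagma.length length_eq_of_commCon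

/-- The free commutative (nonassociative, nonunital) algebra over `K` on the set `X`: the vector
space with basis the commutative monomials, with the bilinear extension of their product. -/
abbrev FreeCommAlg (K : Type u) [Field K] (X : Type v) : Type (max u v) :=
  MonoidAlgebra K (CommMonomial X)

theorem freeCommAlg_mul_comm {K : Type u} [Field K] {X : Type v} (a b : FreeCommAlg K X) :
    a * b = b * a := by
  induction a using MonoidAlgebra.induction_linear with
  | zero => simp
  | add f g hf hg => rw [add_mul, mul_add, hf, hg]
  | single m r =>
    induction b using MonoidAlgebra.induction_linear with
    | zero => simp
    | add f g hf hg => rw [add_mul, mul_add, hf, hg]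
    | single n s =>
      rw [MonoidAlgebra.single_mul_single, MonoidAlgebra.single_mul_single,
        commMonomial_mul_comm m n, mul_comm r s]

/-- `dimBelow K n k`: the dimension of the subspace of the free commutative algebra on `k`
generators that is spanned by the monomials of degree less than `n`. -/
noncomputable def dimBelow (K : Type u) [Field K] (n k : ℕ) : ℕ :=
  Module.finrank K (Submodule.span K
    {f : FreeCommAlg K (Fin k) |
      ∃ p : CommMonomial (Fin k), p.degree < n ∧ f = MonoidAlgebra.single p 1})

/-! ### The free commutative algebra satisfying `x ^ 3 = 0` -/

/-- The ideal of the free commutative algebra generated by all cubes `a (a a)`: the smallest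
subspace that contains the cubes and is closed under multiplication by arbitrary elements. -/
noncomputable def cubeIdeal (K : Type u) [Field K] (X : Type v) :
    Submodule K (FreeCommAlg K X) :=
  sInf {N | (∀ a : FreeCommAlg K X, a * (a * a) ∈ N) ∧
    ∀ a : FreeCommAlg K X, ∀ b ∈ N, a * b ∈ N}

theorem mul_mem_cubeIdeal {K : Type u} [Field K] {X : Type v} (a : FreeCommAlg K X)
    {b : FreeCommAlg K X} (hb : b ∈ cubeIdeal K X) : a * b ∈ cubeIdeal K X := by
  rw [cubeIdeal, Submodule.mem_sInf] at hb ⊢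
  exact fun N hN => hN.2 a b (hb N hN)

/-- The free commutative algebra over `K` on the set `X` satisfying the identity `x ^ 3 = 0`. -/
abbrev FreeCubeZeroAlg (K : Type u) [Field K] (X : Type v) : Type (max u v) :=
  FreeCommAlg K X ⧸ cubeIdeal K X

/-- The product on the quotient by the ideal of cubes, induced by the product of
representatives. -/
noncomputable instance FreeCubeZeroAlg.instMul (K : Type u) [Field K] (X : Type v) :
    Mul (FreeCubeZeroAlg K X) where
  mul := Quotient.map₂ (· * ·) (by
    intro a a' ha b b' hb
    have ha' : a - a' ∈ cubeIdeal K X := (Submodule.quotientRel_def _).1 ha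
    have hb' : b - b' ∈ cubeIdeal K X := (Submodule.quotientRel_def _).1 hb
    refine (Submodule.quotientRel_def _).2 ?_
    have h : a * b - a' * b' = b * (a - a') + a' * (b - b') := by
      rw [mul_sub, mul_sub, freeCommAlg_mul_comm b a, freeCommAlg_mul_comm b a']
      abel
    change a * b - a' * b' ∈ cubeIdeal K X
    rw [h]
    exact add_mem (mul_mem_cubeIdeal _ ha') (mul_mem_cubeIdeal _ hb'))

noncomputable instance FreeCubeZeroAlg.instRing (K : Type u) [Field K] (X : Type v) :
    NonUnitalNonAssocCommRing (FreeCubeZeroAlg K X) where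
  __ := (inferInstance : AddCommGroup (FreeCommAlg K X ⧸ cubeIdeal K X))
  __ := FreeCubeZeroAlg.instMul K X
  left_distrib := by
    rintro ⟨a⟩ ⟨b⟩ ⟨c⟩
    exact congrArg (Submodule.Quotient.mk (p := cubeIdeal K X)) (mul_add a b c)
  right_distrib := by
    rintro ⟨a⟩ ⟨b⟩ ⟨c⟩
    exact congrArg (Submodule.Quotient.mk (p := cubeIdeal K X)) (add_mul a b c)
  zero_mul := by
    rintro ⟨a⟩
    exact congrArg (Submodule.Quotient.mk (p := cubeIdeal K X)) (zero_mul a)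
  mul_zero := by
    rintro ⟨a⟩
    exact congrArg (Submodule.Quotient.mk (p := cubeIdeal K X)) (mul_zero a)
  mul_comm := by
    rintro ⟨a⟩ ⟨b⟩
    exact congrArg (Submodule.Quotient.mk (p := cubeIdeal K X)) (freeCommAlg_mul_comm a b)

/-!
Let `I` be the span of the cubes. Polarizing `L_x ^ 3 + γ L_{x ^ 3} = 0` shows that `I` is an
ideal, and that `x ^ 3` annihilates the polarized cubes `x (y y) + 2 y (x y)`, whence `I I = 0`.

On `I`, the left multiplications by monomials therefore satisfy two identities: the symmetrized
product of any three of them vanishes, and an anticommutator can be moved past a letter up to the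
factor `-2 γ` and words with fewer letters. Induction on the number of letters, at fixed degree,
makes a word skew-symmetric as soon as a letter repeats, because `(2 γ) ^ 2 ≠ 1`, so it vanishes; in
long words a letter does repeat, only finitely many monomials having a nonzero action on `I`.

Modulo `I` the algebra satisfies `x ^ 3 = 0`. There the words in the left multiplications by `k + 1`
generators are words in letters `p x ^ e`, where `x` comes from the last generator and `p` from a
monomial in the others. By induction on `k` finitely many `p` are nonzero, and long words are
again skew-symmetric in the `p`.

So all words of some length `M` in the left multiplications vanish on the whole algebra: `n - 1`
letters lead into `I`, and the others kill `I`. A product of `2 ^ M` elements contains a chain of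
`M` nested multiplications, so it is zero.
-/

section CubicIdentity

variable {K : Type u} [Field K] {A : Type v} [NonUnitalNonAssocCommRing A]

/-- The symmetric trilinear form with `cubeForm x x x = 3 x ^ 3`. -/
def cubeForm (a b c : A) : A := a * (b * c) + b * (a * c) + c * (a * b)

theorem cubeForm_add_self (x y : A) : cubeForm (x + y) (x + y) (x + y)
    = cubeForm x x x + 3 • cubeForm x x y + 3 • cubeForm x y y + cubeForm y y y := by
  simp only [cubeForm, mul_add, add_mul, mul_comm y x]; abel

theorem cubeForm_sub_self (x y : A) : cubeForm (x - y) (x - y) (x - y)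
    = cubeForm x x x - 3 • cubeForm x x y + 3 • cubeForm x y y - cubeForm y y y := by
  simp only [cubeForm, mul_sub, sub_mul, mul_comm y x]; abel

variable [Module K A]

theorem cubeForm_self (x : A) : cubeForm x x x = (3 : K) • (x * (x * x)) := by
  rw [cubeForm]; module

theorem cubeForm_comm_left (a b c : A) : cubeForm a b c = cubeForm b a c := by
  rw [cubeForm, cubeForm, mul_comm a b]; abel

theorem cubeForm_rotate (a b c : A) : cubeForm a b c = cubeForm b c a := by
  rw [cubeForm, cubeForm, mul_comm c a, mul_comm b a]; abel

theorem cubeForm_self_mul_cubeForm_self_eq_zero (h2 : (2 : K) ≠ 0)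
    (h : ∀ x y : A, cubeForm x x x * cubeForm x y y = 0) (x y : A) :
    cubeForm x x x * cubeForm y y y = 0 := by
  have hright (a : A) : cubeForm a (x + y) (x + y)
      = cubeForm a x x + 2 • cubeForm a x y + cubeForm a y y := by
    simp only [cubeForm, mul_add, add_mul, mul_comm y x]; module
  have hadd' : cubeForm (x + y) y y = cubeForm x y y + cubeForm y y y := by
    simp only [cubeForm, mul_add, add_mul]; abel
  have hsub' : cubeForm (x - y) y y = cubeForm x y y - cubeForm y y y := by
    simp only [cubeForm, mul_sub, sub_mul]; abel
  have hxx := h x x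
  have hyy := h y y
  have hxy := h x y
  have hyx := h y x
  have hx := h x (x + y)
  have hy := h y (x + y)
  have hp := h (x + y) y
  have hm := h (x - y) y
  have hpp := h (x + y) (x + y)
  have hmm := h (x - y) (x - y)
  rw [cubeForm_rotate y x x] at hyx
  rw [hright] at hx hy
  rw [cubeForm_rotate y x x, cubeForm_comm_left y x y] at hy
  rw [cubeForm_add_self, hadd'] at hp
  rw [cubeForm_sub_self, hsub'] at hm
  rw [cubeForm_add_self] at hpp
  rw [cubeForm_sub_self] at hmm
  generalize cubeForm x x x = a, cubeForm x x y = b, cubeForm x y y = c, cubeForm y y y = d at *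
  -- The parts of bidegree `(3, 3)` of `h` at `x ± y` give `a d + 3 b c = 0` and `a d + 9 b c = 0`.
  refine (smul_eq_zero_iff_right (pow_ne_zero 3 h2)).1 ?_
  simp only [mul_add, add_mul, mul_sub, sub_mul, smul_mul_assoc, mul_smul_comm, mul_comm b a,
    mul_comm c a, mul_comm c b, mul_comm d] at *
  linear_combination (norm := module) (6 : K) • (hp - hm) - (hpp - hmm) + (6 : K) • (hx - hxx - hxy)
    - (18 : K) • (hy - hyx - hyy)

variable [SMulCommClass K A A] {γ : K}

namespace SatisfiesCubicIdentity

theorem apply (hA : SatisfiesCubicIdentity K A γ) (x v : A) :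
    x * (x * (x * v)) + γ • ((x * (x * x)) * v) = 0 := by
  simpa using LinearMap.congr_fun (hA x) v

theorem polarized (hA : SatisfiesCubicIdentity K A γ) (a b c v : A) :
    a * (b * (c * v)) + a * (c * (b * v)) + b * (a * (c * v)) + b * (c * (a * v))
      + c * (a * (b * v)) + c * (b * (a * v)) + (2 * γ) • (cubeForm a b c * v) = 0 := by
  have h (x : A) := hA.apply x v
  have habc := h (a + b + c)
  have hab := h (a + b)
  have hac := h (a + c)
  have hbc := h (b + c)
  simp only [cubeForm, add_mul, mul_add, mul_comm b a, mul_comm c a, mul_comm c b] at *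
  linear_combination (norm := module) habc - hab - hac - hbc + h a + h b + h c

theorem mul_cube_self (hA : SatisfiesCubicIdentity K A γ) (hγ : γ ≠ -1) (x : A) :
    x * (x * (x * x)) = 0 := by
  have h : (1 + γ) • (x * (x * (x * x))) = 0 := by
    rw [← hA.apply x x, mul_comm (x * (x * x)) x]; module
  exact (smul_eq_zero.1 h).resolve_left fun h => hγ (by linear_combination h)

/-- The polarization of `x x ^ 3 = 0`. -/
theorem sum_mul_cubeForm (hA : SatisfiesCubicIdentity K A γ) (h2 : (2 : K) ≠ 0)
    (hγ : γ ≠ -1) (w x y z : A) :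
    w * cubeForm x y z + x * cubeForm w y z + y * cubeForm w x z + z * cubeForm w x y = 0 := by
  have H := hA.mul_cube_self hγ
  have hwxyz := H (w + x + y + z)
  have hwxy := H (w + x + y)
  have hwxz := H (w + x + z)
  have hwyz := H (w + y + z)
  have hxyz := H (x + y + z)
  have hwx := H (w + x)
  have hwy := H (w + y)
  have hwz := H (w + z)
  have hxy := H (x + y)
  have hxz := H (x + z)
  have hyz := H (y + z)
  refine (smul_eq_zero_iff_right h2).1 ?_
  simp only [cubeForm, add_mul, mul_add, mul_comm x w, mul_comm y w, mul_comm z w, mul_comm y x,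
    mul_comm z x, mul_comm z y] at *
  linear_combination (norm := module) hwxyz - hwxy - hwxz - hwyz - hxyz + hwx + hwy + hwz + hxy
    + hxz + hyz - H w - H x - H y - H z

theorem cubeForm_mul (hA : SatisfiesCubicIdentity K A γ) (h2 : (2 : K) ≠ 0) (hγ : γ ≠ -1)
    (a b y z : A) :
    cubeForm (a * b) y z = cubeForm a b (y * z)
      + (2 * γ) • (y * cubeForm a b z + z * cubeForm a b y) := by
  -- The polarized identities with `{a, b}` and `{y, z}` exchanged have almost the same terms.
  have hyza := hA.polarized y z a b
  have hyzb := hA.polarized y z b a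
  have haby := hA.polarized a b y z
  have habz := hA.polarized a b z y
  have hsum := hA.sum_mul_cubeForm h2 hγ a b y z
  refine (smul_right_inj h2).1 ?_
  simp only [cubeForm, mul_add, mul_comm] at *
  linear_combination (norm := module) hyza + hyzb - haby - habz - (2 * γ) • hsum

theorem cubeForm_mul_eq_sub (hA : SatisfiesCubicIdentity K A γ) (h2 : (2 : K) ≠ 0) (hγ : γ ≠ -1)
    (a b y z : A) :
    cubeForm (a * b) y z = cubeForm a b (y * z)
      - (2 * γ) • (a * cubeForm b y z + b * cubeForm a y z) := by
  rw [hA.cubeForm_mul h2 hγ, mul_comm z]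
  have hsum := hA.sum_mul_cubeForm h2 hγ a b y z
  rw [mul_comm z] at hsum
  linear_combination (norm := module) (2 * γ) • hsum

theorem mul_cube_mul (hA : SatisfiesCubicIdentity K A γ) (hγ0 : γ ≠ 0) (x v : A) :
    x * ((x * (x * x)) * v) = (x * (x * x)) * (x * v) := by
  have h := congrArg (x * ·) (hA.apply x v)
  simp only [mul_add, mul_smul_comm, mul_zero] at h
  refine (smul_right_inj hγ0).1 ?_
  linear_combination (norm := module) h - hA.apply x (x * v)

theorem mul_sq_mul_add (hA : SatisfiesCubicIdentity K A γ) (h2 : (2 : K) ≠ 0) (hγ : γ ≠ -1)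
    (x y v : A) :
    x * ((y * y) * v) + (2 : K) • (y * ((x * y) * v)) = (2 * γ - 1) • (cubeForm x y y * v) := by
  have hsum := hA.sum_mul_cubeForm h2 hγ v x y y
  have hpol := hA.polarized x y y v
  simp only [cubeForm, mul_add, mul_comm] at *
  linear_combination (norm := module) hsum - hpol

theorem mul_sq_mul (hA : SatisfiesCubicIdentity K A γ) (h2 : (2 : K) ≠ 0) (h3 : (3 : K) ≠ 0)
    (hγ : γ ≠ -1) (x v : A) :
    x * ((x * x) * v) = (2 * γ - 1) • ((x * (x * x)) * v) := by
  have h := hA.mul_sq_mul_add h2 hγ x x v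
  rw [cubeForm_self (K := K), mul_comm (_ • _), mul_smul_comm, mul_comm v] at h
  refine (smul_right_inj h3).1 ?_
  linear_combination (norm := module) h

theorem sq_mul_sq_mul_and_sq_mul_sq_mul (hA : SatisfiesCubicIdentity K A γ) (h2 : (2 : K) ≠ 0)
    (h3 : (3 : K) ≠ 0) (hγ : γ ≠ -1) (hγ0 : γ ≠ 0) (x v : A) :
    ((x * x) * (x * x)) * v = (-4 * (2 * γ - 1)) • ((x * (x * x)) * (x * v)) ∧
      (x * x) * ((x * x) * v) = (-4 * (2 * γ - 1) ^ 2 - 2) • ((x * (x * x)) * (x * v)) := by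
  have hcom := hA.mul_cube_mul hγ0 x v
  have hsq (v : A) := hA.mul_sq_mul h2 h3 hγ x v
  have hform (v : A) : cubeForm x x v = (x * x) * v + (2 : K) • (x * (x * v)) := by
    rw [cubeForm, mul_comm v]; module
  have hform' (v : A) : cubeForm (x * x) x v
      = (x * x) * (x * v) + (2 * γ) • ((x * (x * x)) * v) := by
    rw [cubeForm, hsq, mul_comm v, mul_comm (x * x) x]; module
  have hform'' (v : A) : cubeForm (x * x) (x * x) v
      = (2 : K) • ((x * x) * ((x * x) * v)) + ((x * x) * (x * x)) * v := by
    rw [cubeForm, mul_comm v]; module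
  have hpol := hA.polarized (x * x) x x v
  have hsum := hA.sum_mul_cubeForm h2 hγ v (x * x) x x
  have hmul := hA.cubeForm_mul_eq_sub h2 hγ x x (x * x) v
  have hzero : cubeForm (x * x) x x = (x * x) * (x * x) := by
    rw [hform', mul_comm (x * (x * x)), hA.mul_cube_self hγ, smul_zero, add_zero]
  rw [hzero] at hpol hsum
  rw [cubeForm_rotate v, cubeForm_rotate v, hform, hform', mul_comm v] at hsum
  rw [hform, hform'', cubeForm_comm_left x, hform'] at hmul
  simp only [hsq, hcom, mul_add, mul_smul_comm] at hpol hsum hmul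
  have hz : ((x * x) * (x * x)) * v = (-4 * (2 * γ - 1)) • ((x * (x * x)) * (x * v)) := by
    refine (smul_right_inj (mul_ne_zero h2 hγ0)).1 ?_
    linear_combination (norm := module) hmul + hpol - hsum
  exact ⟨hz, by linear_combination (norm := module) hmul - hz⟩

theorem cube_mul_mul_sq_and_mul_cube_mul (hA : SatisfiesCubicIdentity K A γ) (h2 : (2 : K) ≠ 0)
    (hγ : γ ≠ -1) (hγ0 : γ ≠ 0) (hγ2 : γ ≠ 1 / 2) (x y : A) :
    (x * (x * x)) * (x * (y * y)) = (2 * γ) • ((x * (x * x)) * cubeForm x y y) ∧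
      (2 : K) • (y * ((x * (x * x)) * (x * y))) = -((x * (x * x)) * cubeForm x y y) := by
  have hcom (v : A) := hA.mul_cube_mul hγ0 x v
  have hzero := hA.mul_cube_self hγ x
  have hm : 2 * (2 * γ - 1) ≠ 0 :=
    mul_ne_zero h2 fun h => hγ2 (by field_simp; linear_combination h)
  have hsq := hA.mul_sq_mul_add h2 hγ x y (x * (x * x))
  have hpol := hA.polarized x y y (x * (x * x))
  have hmul := hA.cubeForm_mul h2 hγ x y (x * (x * x)) y
  have hform : cubeForm x y y = x * (y * y) + (2 : K) • (y * (x * y)) := by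
    rw [cubeForm]; module
  generalize x * (x * x) = u at *
  have hxyu : cubeForm x y u = (2 : K) • (u * (x * y)) := by
    rw [cubeForm, mul_comm y u, hcom, hzero, mul_zero]; module
  have hxyuy : cubeForm x y (u * y)
      = x * (y * (u * y)) + y * (u * (x * y)) + (u * y) * (x * y) := by
    rw [cubeForm, hcom]
  have hxyuy' : cubeForm (x * y) u y
      = (u * y) * (x * y) + u * (y * (x * y)) + y * (u * (x * y)) := by
    rw [cubeForm, mul_comm (x * y), mul_comm (x * y), mul_comm (x * y) u]
  simp only [hform, hxyu, hxyuy, hxyuy', hzero, hcom, mul_comm _ u, mul_add, mul_smul_comm,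
    mul_zero] at hmul hsq hpol ⊢
  have ha : u * (x * (y * y)) = (2 * γ) • (u * (x * (y * y)) + (2 : K) • (u * (y * (x * y)))) := by
    refine (smul_right_inj hm).1 ?_
    linear_combination (norm := module) (2 : K) • hmul + hpol + (4 * γ - 1) • hsq
  exact ⟨ha, by linear_combination (norm := module) hsq - ha⟩

theorem cube_mul_cubeForm_eq_zero (hA : SatisfiesCubicIdentity K A γ) (h2 : (2 : K) ≠ 0)
    (h3 : (3 : K) ≠ 0) (hγ : γ ≠ -1) (hγ0 : γ ≠ 0) (hγ2 : γ ≠ 1 / 2) (x y : A) :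
    (x * (x * x)) * cubeForm x y y = 0 := by
  obtain ⟨ha, he⟩ := hA.cube_mul_mul_sq_and_mul_cube_mul h2 hγ hγ0 hγ2 x y
  have hm : -4 * (2 * γ - 1) ^ 2 ≠ 0 := by
    have h4 : (-4 : K) ≠ 0 := by
      simpa [show (-4 : K) = -(2 * 2) by norm_num] using h2
    exact mul_ne_zero h4 (pow_ne_zero _ fun h => hγ2 (by field_simp; linear_combination h))
  have hz (v : A) := (hA.sq_mul_sq_mul_and_sq_mul_sq_mul h2 h3 hγ hγ0 x v).1
  have hs (v : A) := (hA.sq_mul_sq_mul_and_sq_mul_sq_mul h2 h3 hγ hγ0 x v).2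
  have hform (a v : A) : cubeForm a v v = a * (v * v) + (2 : K) • (v * (a * v)) := by
    rw [cubeForm]; module
  have hform' (a v : A) : cubeForm a a v = (2 : K) • (a * (a * v)) + (a * a) * v := by
    rw [cubeForm, mul_comm v]; module
  have hmul := hA.cubeForm_mul h2 hγ (x * x) (x * x) y y
  simp only [hform ((x * x) * (x * x)), hform', hz, hs, mul_add, mul_smul_comm] at hmul
  refine (smul_eq_zero_iff_right hm).1 ?_
  linear_combination (norm := module) hmul - (8 * (2 * γ - 1) ^ 2 + 4) • ha
    - (2 * γ * (8 * (2 * γ - 1) ^ 2 + 4 * (2 * γ - 1) + 4) - 4 * (2 * γ - 1)) • he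

end SatisfiesCubicIdentity

end CubicIdentity

section Words

variable {K V G : Type*} [Field K] [AddCommGroup V] [Module K V]

theorem eq_zero_of_skew_of_not_nodup (h2 : (2 : K) ≠ 0) (f : List G → V) (l : List G)
    (hf : ∀ u a b w, (u ++ a :: b :: w).Perm l → f (u ++ a :: b :: w) + f (u ++ b :: a :: w) = 0)
    (hl : ¬ l.Nodup) : f l = 0 := by
  have iff_of_perm {l₁ l₂ : List G} (h : l₁.Perm l₂) : ∀ u, (u ++ l₁).Perm l →
      (f (u ++ l₁) = 0 ↔ f (u ++ l₂) = 0) := by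
    induction h with
    | nil => exact fun u _ => Iff.rfl
    | cons a _ ih => simpa using fun u => ih (u ++ [a])
    | swap a b w =>
      intro u hu
      rw [eq_neg_of_add_eq_zero_left (hf u b a w hu), neg_eq_zero]
    | trans h _ ih₁ ih₂ =>
      exact fun u hu => (ih₁ u hu).trans (ih₂ u (((h.append_left u).symm).trans hu))
  obtain ⟨a, ha⟩ := List.exists_duplicate_iff_not_nodup.2 hl
  obtain ⟨w, hw⟩ := (List.duplicate_iff_sublist.1 ha).exists_perm_append
  refine (iff_of_perm hw [] (List.Perm.refl l)).2 ?_
  have h := hf [] a a w hw.symm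
  rw [← two_smul K] at h
  exact (smul_eq_zero_iff_right h2).1 h

/-- The value of a function `f` of words on `u (a b + b a) w`, where `f` is extended linearly. -/
def anticommutatorAt (f : List G → V) (u : List G) (a b : G) (w : List G) : V :=
  f (u ++ a :: b :: w) + f (u ++ b :: a :: w)

/-- The relations between the values of a function `f` on the rearrangements of the word `l`
which hold when `f` is a multiplicative function into a ring where anticommutators of letters
commute with letters up to the factor `-k` and the symmetrized product of any three letters is
zero. -/
structure AnticommutatorRelations (k : K) (f : List G → V) (l : List G) : Prop where
  move : ∀ u a b c w, (u ++ a :: b :: c :: w).Perm l →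
    anticommutatorAt f u a b (c :: w) + k • anticommutatorAt f (u ++ [c]) a b w = 0
  cyclic : ∀ u a b c w, (u ++ a :: b :: c :: w).Perm l →
    anticommutatorAt f u a b (c :: w) + anticommutatorAt f u b c (a :: w)
      + anticommutatorAt f u c a (b :: w) = 0

namespace AnticommutatorRelations

variable {k : K} {f : List G → V} {l : List G}

theorem anticommutatorAt_adjacent (hf : AnticommutatorRelations k f l) (hk : k ^ 2 ≠ 1)
    {u : List G} {a b c d : G} {w : List G} (hl : (u ++ a :: b :: c :: d :: w).Perm l) :
    anticommutatorAt f u a b (c :: d :: w) + anticommutatorAt f u a b (d :: c :: w) = 0 := by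
  classical
  have hc := hf.cyclic u a b c (d :: w) (by grind)
  have hd := hf.cyclic u a b d (c :: w) (by grind)
  have ha := hf.cyclic (u ++ [a]) b c d w (by grind)
  have hb := hf.cyclic (u ++ [b]) c a d w (by grind)
  have hbc := hf.move u b c a (d :: w) (by grind)
  have hca := hf.move u c a b (d :: w) (by grind)
  have hbd := hf.move u b d a (c :: w) (by grind)
  have hda := hf.move u d a b (c :: w) (by grind)
  have hcd := hf.move (u ++ [a]) c d b w (by grind)
  have hcd' := hf.move (u ++ [b]) d c a w (by grind)
  refine (smul_eq_zero_iff_right (sub_ne_zero.2 hk.symm)).1 ?_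
  simp only [anticommutatorAt, List.append_assoc, List.cons_append, List.nil_append] at *
  linear_combination (norm := module) hc + hd + k • (ha + hb) - hbc - hca - hbd - hda
    - k • (hcd + hcd')

theorem anticommutatorAt_append (hf : AnticommutatorRelations k f l) (hk : k ^ 2 ≠ 1)
    (v : List G) {u : List G} {a b c d : G} {w : List G}
    (hl : (u ++ a :: b :: (v ++ c :: d :: w)).Perm l) :
    anticommutatorAt f u a b (v ++ c :: d :: w)
      + anticommutatorAt f u a b (v ++ d :: c :: w) = 0 := by
  classical
  induction v generalizing u with
  | nil => exact hf.anticommutatorAt_adjacent hk hl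
  | cons e v ih =>
    have h := ih (u := u ++ [e]) (by grind)
    have hcd := hf.move u a b e (v ++ c :: d :: w) hl
    have hdc := hf.move u a b e (v ++ d :: c :: w) (by grind)
    simp only [List.cons_append]
    linear_combination (norm := module) hcd + hdc - k • h

theorem anticommutatorAt_nil [DecidableEq G] (hf : AnticommutatorRelations k f l)
    (h2 : (2 : K) ≠ 0) (hk : k ^ 2 ≠ 1) (hlen : l.toFinset.card + 3 ≤ l.length) {u : List G}
    {a b : G} (hl : (u ++ [a, b]).Perm l) : anticommutatorAt f u a b [] = 0 := by
  refine eq_zero_of_skew_of_not_nodup h2 (fun u => anticommutatorAt f u a b []) u ?_ ?_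
  · intro v c d w hv
    have h := hf.anticommutatorAt_append hk w (u := v) (a := c) (b := d) (c := a) (d := b)
      (w := []) (by grind)
    simp only [anticommutatorAt, List.append_assoc, List.cons_append] at h ⊢
    linear_combination (norm := module) h
  · intro hu
    have hsub : u.toFinset ⊆ l.toFinset := by
      simpa [Finset.subset_iff, ← hl.mem_iff] using fun p hp => Or.inl hp
    have hcard := Finset.card_le_card hsub
    rw [List.toFinset_card_of_nodup hu] at hcard
    have := hl.length_eq
    simp at this
    omega

theorem anticommutatorAt_eq_zero [DecidableEq G] (hf : AnticommutatorRelations k f l)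
    (h2 : (2 : K) ≠ 0) (hk : k ^ 2 ≠ 1) (hlen : l.toFinset.card + 3 ≤ l.length) (w : List G)
    {u : List G} {a b : G} (hl : (u ++ a :: b :: w).Perm l) : anticommutatorAt f u a b w = 0 := by
  induction w generalizing u with
  | nil => exact hf.anticommutatorAt_nil h2 hk hlen hl
  | cons c w ih =>
    have h := hf.move u a b c w hl
    rwa [ih (u := u ++ [c]) (by grind), smul_zero, add_zero] at h

theorem eq_zero [DecidableEq G] (hf : AnticommutatorRelations k f l) (h2 : (2 : K) ≠ 0)
    (hk : k ^ 2 ≠ 1) (hlen : l.toFinset.card + 3 ≤ l.length) : f l = 0 := by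
  refine eq_zero_of_skew_of_not_nodup h2 f l
    (fun u a b w hl => hf.anticommutatorAt_eq_zero h2 hk hlen w hl) fun hl => ?_
  rw [List.toFinset_card_of_nodup hl] at hlen
  omega

end AnticommutatorRelations

/-- The identities satisfied by `ρ`, the left multiplications by the elements of a commutative
algebra with `L_x ^ 3 + γ L_{x ^ 3} = 0`, on an ideal that is annihilated by all cubes; here
`k = 2 γ`. -/
structure IsCubicRepresentation {R : Type*} [Ring R] [Algebra K R] [Mul G] (k : K) (ρ : G → R) :
    Prop where
  symmetrized : ∀ a b c, ρ a * ρ b * ρ c + ρ a * ρ c * ρ b + ρ b * ρ a * ρ c + ρ b * ρ c * ρ a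
    + ρ c * ρ a * ρ b + ρ c * ρ b * ρ a = 0
  map_mul_mul : ∀ a b c, ρ (a * b * c) + ρ (a * b) * ρ c + ρ c * ρ (a * b)
    = (ρ (a * b) + ρ a * ρ b + ρ b * ρ a) * ρ c
      + k • (ρ c * (ρ (a * b) + ρ a * ρ b + ρ b * ρ a))

namespace IsCubicRepresentation

variable {R : Type*} [Ring R] [Algebra K R] [Mul G] {k : K} {ρ : G → R} {deg : G → ℕ}

theorem anticommutatorRelations (hρ : IsCubicRepresentation k ρ)
    (hdeg : ∀ a b, deg (a * b) = deg a + deg b) {l : List G}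
    (hl : ∀ l' : List G, l'.length < l.length → (l'.map deg).sum = (l.map deg).sum →
      (l'.map ρ).prod = 0) :
    AnticommutatorRelations k (fun l => (l.map ρ).prod) l where
  move u a b c w hw := by
    have hlen := hw.length_eq
    have hsum := (hw.map deg).sum_eq
    simp only [List.length_append, List.length_cons, List.map_append, List.map_cons,
      List.sum_append, List.sum_cons] at hlen hsum
    have habc := hl (u ++ a * b * c :: w) (by simp; omega) (by simp [hdeg]; omega)
    have hab := hl (u ++ c :: a * b :: w) (by simp; omega) (by simp [hdeg]; omega)
    have h := congrArg (fun t => (u.map ρ).prod * t * (w.map ρ).prod) (hρ.map_mul_mul a b c)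
    simp only [anticommutatorAt, List.map_append, List.map_cons, List.prod_append, List.prod_cons,
      List.map_nil, List.prod_nil, mul_add, add_mul, smul_mul_assoc, mul_smul_comm, mul_assoc,
      smul_add, one_mul] at habc hab h ⊢
    linear_combination (norm := module) habc + hab - k • hab - h
  cyclic u a b c w _ := by
    have h := congrArg (fun t => (u.map ρ).prod * t * (w.map ρ).prod) (hρ.symmetrized a b c)
    simp only [anticommutatorAt, List.map_append, List.map_cons, List.prod_append, List.prod_cons,
      mul_add, add_mul, mul_assoc, mul_zero, zero_mul] at h ⊢
    linear_combination (norm := abel) h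

theorem prod_map_eq_zero (hρ : IsCubicRepresentation k ρ) (h2 : (2 : K) ≠ 0) (hk : k ^ 2 ≠ 1)
    (hdeg : ∀ a b, deg (a * b) = deg a + deg b) {T : Finset G} {N : ℕ}
    (hT : ∀ p ∉ T, ρ p = 0) (hN : ∀ p ∈ T, deg p ≤ N) (l : List G)
    (hl : (T.card + 2) * N < (l.map deg).sum) : (l.map ρ).prod = 0 := by
  classical
  induction hm : l.length using Nat.strong_induction_on generalizing l with
  | _ m ih =>
    subst hm
    by_cases hlT : ∀ p ∈ l, p ∈ T
    · have hcard : l.toFinset.card ≤ T.card :=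
        Finset.card_le_card fun p hp => hlT p (List.mem_toFinset.1 hp)
      have hsum : (l.map deg).sum ≤ l.length * N := by
        simpa using List.sum_le_card_nsmul (l.map deg) N
          (by simpa using fun p hp => hN p (hlT p hp))
      have hlen : T.card + 2 < l.length := lt_of_mul_lt_mul_right (hl.trans_le hsum) N.zero_le
      exact (hρ.anticommutatorRelations hdeg fun l' hlt hl' =>
        ih _ hlt l' (hl' ▸ hl) rfl).eq_zero h2 hk (by omega)
    · push Not at hlT
      obtain ⟨p, hp, hpT⟩ := hlT
      exact List.prod_eq_zero (List.mem_map.2 ⟨p, hp, hT p hpT⟩)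

end IsCubicRepresentation

end Words

section CubeSpan

variable {K : Type u} [Field K] {A : Type v} [NonUnitalNonAssocCommRing A] [Module K A]

variable (K A) in
/-- The subspace spanned by the cubes `x (x x)`; it is an ideal with zero product in an algebra
satisfying `L_x ^ 3 + γ L_{x ^ 3} = 0`. -/
def cubeSpan : Submodule K A := Submodule.span K (Set.range fun x : A => x * (x * x))

theorem cube_mem_cubeSpan (x : A) : x * (x * x) ∈ cubeSpan K A :=
  Submodule.subset_span ⟨x, rfl⟩

theorem cubeForm_mem_cubeSpan (h2 : (2 : K) ≠ 0) (a b c : A) : cubeForm a b c ∈ cubeSpan K A := by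
  have h : (2 : K) • cubeForm a b c = (a + b + c) * ((a + b + c) * (a + b + c))
      - (a + b) * ((a + b) * (a + b)) - (a + c) * ((a + c) * (a + c))
      - (b + c) * ((b + c) * (b + c)) + a * (a * a) + b * (b * b) + c * (c * c) := by
    simp only [cubeForm, two_smul, mul_add, add_mul, mul_comm c b, mul_comm c a, mul_comm b a]
    abel
  refine (Submodule.smul_mem_iff _ h2).1 (h ▸ ?_)
  have hcube := cube_mem_cubeSpan (K := K) (A := A)
  refine add_mem (add_mem (add_mem (sub_mem (sub_mem (sub_mem ?_ ?_) ?_) ?_) ?_) ?_) ?_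
  all_goals exact hcube _

namespace SatisfiesCubicIdentity

variable [SMulCommClass K A A] {γ : K}

theorem mul_cube_mem_cubeSpan (hA : SatisfiesCubicIdentity K A γ) (h2 : (2 : K) ≠ 0)
    (h3 : (3 : K) ≠ 0) (hγ : γ ≠ -1) (hγ0 : γ ≠ 0) (a x : A) :
    a * (x * (x * x)) ∈ cubeSpan K A := by
  have hsum := hA.sum_mul_cubeForm h2 hγ a x x x
  have hmul := hA.cubeForm_mul h2 hγ x x x a
  rw [cubeForm_self (K := K), mul_smul_comm] at hsum hmul
  rw [cubeForm_rotate a x x] at hsum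
  have h : (12 * γ) • (a * (x * (x * x)))
      = (3 : K) • (cubeForm (x * x) x a - cubeForm x x (x * a)) := by
    linear_combination (norm := module) (-3 : K) • hmul - (2 * γ) • hsum
  have h12 : 12 * γ ≠ 0 := by
    rw [show (12 : K) = 2 * 2 * 3 by norm_num]
    exact mul_ne_zero (mul_ne_zero (mul_ne_zero h2 h2) h3) hγ0
  refine (Submodule.smul_mem_iff _ h12).1 (h ▸ Submodule.smul_mem _ _ (sub_mem ?_ ?_))
  all_goals exact cubeForm_mem_cubeSpan h2 _ _ _

theorem mul_mem_cubeSpan (hA : SatisfiesCubicIdentity K A γ) (h2 : (2 : K) ≠ 0)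
    (h3 : (3 : K) ≠ 0) (hγ : γ ≠ -1) (hγ0 : γ ≠ 0) (a : A) {b : A} (hb : b ∈ cubeSpan K A) :
    a * b ∈ cubeSpan K A := by
  have hle : cubeSpan K A ≤ (cubeSpan K A).comap (LinearMap.mulLeft K a) :=
    Submodule.span_le.2 <| Set.range_subset_iff.2 <| hA.mul_cube_mem_cubeSpan h2 h3 hγ hγ0 a
  exact hle hb

variable [IsScalarTower K A A]

theorem mul_eq_zero_of_mem_cubeSpan (hA : SatisfiesCubicIdentity K A γ) (h2 : (2 : K) ≠ 0)
    (h3 : (3 : K) ≠ 0) (hγ : γ ≠ -1) (hγ0 : γ ≠ 0) (hγ2 : γ ≠ 1 / 2) {a b : A}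
    (ha : a ∈ cubeSpan K A) (hb : b ∈ cubeSpan K A) : a * b = 0 := by
  have hcube (x y : A) : (x * (x * x)) * (y * (y * y)) = 0 := by
    have h := cubeForm_self_mul_cubeForm_self_eq_zero h2 (fun x y : A => by
      rw [cubeForm_self (K := K), smul_mul_assoc,
        hA.cube_mul_cubeForm_eq_zero h2 h3 hγ hγ0 hγ2, smul_zero]) x y
    simpa [cubeForm_self (K := K), smul_mul_assoc, mul_smul_comm, h3] using h
  induction ha, hb using Submodule.span_induction₂ with
  | mem_mem a b ha hb =>
    obtain ⟨x, rfl⟩ := ha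
    obtain ⟨y, rfl⟩ := hb
    exact hcube x y
  | zero_left b _ => exact zero_mul b
  | zero_right a _ => exact mul_zero a
  | add_left x y z _ _ _ hx hy => rw [add_mul, hx, hy, add_zero]
  | add_right x y z _ _ _ hy hz => rw [mul_add, hy, hz, add_zero]
  | smul_left r x y _ _ h => rw [smul_mul_assoc, h, smul_zero]
  | smul_right r x y _ _ h => rw [mul_smul_comm, h, smul_zero]

theorem isCubicRepresentation {G : Type*} [Mul G] (hA : SatisfiesCubicIdentity K A γ)
    (h2 : (2 : K) ≠ 0) (h3 : (3 : K) ≠ 0) (hγ : γ ≠ -1) (hγ0 : γ ≠ 0) (hγ2 : γ ≠ 1 / 2)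
    (ev : G →ₙ* A) {ρ : G → Module.End K (cubeSpan K A)}
    (hρ : ∀ p (c : cubeSpan K A), (ρ p c : A) = ev p * c) : IsCubicRepresentation (2 * γ) ρ := by
  have hform (a b c : A) (d : cubeSpan K A) : cubeForm a b c * d = 0 :=
    hA.mul_eq_zero_of_mem_cubeSpan h2 h3 hγ hγ0 hγ2 (cubeForm_mem_cubeSpan h2 a b c) d.2
  have hexpand (a b c : A) : cubeForm a b c = a * (b * c) + b * (a * c) + (a * b) * c := by
    rw [cubeForm, mul_comm c]
  refine ⟨fun a b c => ?_, fun a b c => ?_⟩ <;> ext d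
  · have h := hA.polarized (ev a) (ev b) (ev c) d
    rw [hform, smul_zero, add_zero] at h
    simpa [hρ] using h
  · have h := hA.cubeForm_mul h2 hγ (ev a) (ev b) (ev c) d
    rw [mul_comm (d : A), hform, add_zero] at h
    simp only [hexpand, mul_add] at h
    simp only [LinearMap.add_apply, Module.End.mul_apply, Submodule.coe_add, hρ,
      LinearMap.smul_apply, Submodule.coe_smul, map_mul, mul_add]
    linear_combination (norm := module) h

theorem prod_map_mulLeft_apply_eq_zero {G : Type*} [Mul G] (hA : SatisfiesCubicIdentity K A γ)
    (h2 : (2 : K) ≠ 0) (h3 : (3 : K) ≠ 0) (hγ : γ ≠ -1) (hγ0 : γ ≠ 0) (hγ2 : γ ≠ 1 / 2)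
    (hγ2' : γ ≠ -(1 / 2)) {deg : G → ℕ} (hdeg : ∀ a b, deg (a * b) = deg a + deg b)
    (ev : G →ₙ* A) {T : Finset G} {N : ℕ} (hT : ∀ p ∉ T, ev p ∈ cubeSpan K A)
    (hN : ∀ p ∈ T, deg p ≤ N) (l : List G) (hl : (T.card + 2) * N < (l.map deg).sum)
    {b : A} (hb : b ∈ cubeSpan K A) : (l.map fun p => LinearMap.mulLeft K (ev p)).prod b = 0 := by
  let ρ (p : G) : Module.End K (cubeSpan K A) :=
    (LinearMap.mulLeft K (ev p)).restrict fun _ => hA.mul_mem_cubeSpan h2 h3 hγ hγ0 (ev p)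
  have hρ (p : G) (c : cubeSpan K A) : (ρ p c : A) = ev p * c := rfl
  have hk : (2 * γ) ^ 2 ≠ 1 := by
    rw [sq_ne_one_iff]
    exact ⟨fun h => hγ2 (by field_simp; linear_combination h),
      fun h => hγ2' (by field_simp; linear_combination h)⟩
  have hρT (p : G) (hp : p ∉ T) : ρ p = 0 := by
    ext c
    exact hA.mul_eq_zero_of_mem_cubeSpan h2 h3 hγ hγ0 hγ2 (hT p hp) c.2
  have hprod := (hA.isCubicRepresentation h2 h3 hγ hγ0 hγ2 ev hρ).prod_map_eq_zero h2 hk hdeg hρT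
    hN l hl
  have hcoe (l : List G) (c : cubeSpan K A) :
      (l.map fun p => LinearMap.mulLeft K (ev p)).prod c = ((l.map ρ).prod c : A) := by
    induction l with
    | nil => rfl
    | cons p l ih => simp [ih, hρ]
  rw [hcoe l ⟨b, hb⟩, hprod]
  rfl

end SatisfiesCubicIdentity

end CubeSpan

section Products

theorem exists_lift_id_eq_lift {X : Type*} {A : Type v} [NonUnitalNonAssocRing A] (g : X → A)
    (w : FreeMagma X) {j : ℕ} (hj : 1 ≤ j) (hw : j ≤ w.length) :
    ∃ w' : FreeMagma A, w'.length = j ∧ FreeMagma.lift (id : A → A) w' = FreeMagma.lift g w := by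
  induction w using FreeMagma.recOnMul generalizing j with
  | ih1 a => exact ⟨.of (g a), le_antisymm hj hw, rfl⟩
  | ih2 x y hx hy =>
    change j ≤ x.length + y.length at hw
    have := x.length_pos
    have := y.length_pos
    obtain rfl | hj := hj.eq_or_lt
    · exact ⟨.of (FreeMagma.lift g (x * y)), rfl, rfl⟩
    obtain ⟨x', hx', hxv⟩ := hx (j := min (j - 1) x.length) (by omega) (by omega)
    obtain ⟨y', hy', hyv⟩ := hy (j := j - min (j - 1) x.length) (by omega) (by omega)
    refine ⟨x' * y', ?_, by rw [map_mul, map_mul, hxv, hyv]⟩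
    change x'.length + y'.length = j
    omega

theorem ProductsVanish.lift_eq_zero {X : Type*} {A : Type v} [NonUnitalNonAssocRing A] {n : ℕ}
    (h : ProductsVanish A n) (hn : 1 ≤ n) (g : X → A) {w : FreeMagma X} (hw : n ≤ w.length) :
    FreeMagma.lift g w = 0 := by
  obtain ⟨w', hlen, heq⟩ := exists_lift_id_eq_lift g w hn hw
  rw [← heq, h w' hlen]

theorem ProductsVanish.exists_hasNilpotencyIndex_le {A : Type v} [NonUnitalNonAssocRing A] {N : ℕ}
    (h : ProductsVanish A N) (hN : 0 < N) : ∃ m, HasNilpotencyIndex A m ∧ m ≤ N := by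
  classical
  have hex : ∃ m : ℕ, 0 < m ∧ ProductsVanish A m := ⟨N, hN, h⟩
  exact ⟨Nat.find hex, ⟨Nat.find_spec hex, fun m hm => Nat.find_min' hex hm⟩,
    Nat.find_min' hex ⟨hN, h⟩⟩

theorem span_range_pow_eq_bot {K R G : Type*} [CommSemiring K] [Semiring R] [Algebra K R]
    {f : G → R} {m : ℕ} (h : ∀ l : List G, l.length = m → (l.map f).prod = 0) :
    Submodule.span K (Set.range f) ^ m = ⊥ := by
  rw [Submodule.span_pow, Submodule.span_eq_bot]
  intro r hr
  obtain ⟨s, rfl⟩ := Set.mem_pow.1 hr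
  choose p hp using fun i => (s i).2
  have hprod := h (List.ofFn p) List.length_ofFn
  rw [List.map_ofFn] at hprod
  simpa only [Function.comp_def, hp] using hprod

variable (K : Type u) [Field K] (A : Type v) [NonUnitalNonAssocCommRing A] [Module K A]
  [IsScalarTower K A A] [SMulCommClass K A A]

/-- The space of left multiplications `L_a` of `A`, whose powers control the nilpotency of `A`. -/
def leftMultiplications : Submodule K (Module.End K A) := LinearMap.range (LinearMap.mul K A)

variable {K A}

theorem exists_mem_leftMultiplications_pow (m : ℕ) (w : FreeMagma A) (hw : 2 ^ m ≤ w.length) :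
    ∃ f ∈ leftMultiplications K A ^ m, ∃ b : A, FreeMagma.lift (id : A → A) w = f b := by
  induction m generalizing w with
  | zero => exact ⟨1, Submodule.one_le.1 (pow_zero _).ge, _, rfl⟩
  | succ m ih =>
    induction w using FreeMagma.recOnMul with
    | ih1 a => exact absurd hw (Nat.one_lt_two_pow m.succ_ne_zero).not_ge
    | ih2 x y _ _ =>
      change 2 ^ (m + 1) ≤ x.length + y.length at hw
      have hmul (z : FreeMagma A) {f : Module.End K A} (hf : f ∈ leftMultiplications K A ^ m) :
          LinearMap.mul K A (FreeMagma.lift id z) * f ∈ leftMultiplications K A ^ (m + 1) := by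
        rw [pow_succ']
        exact Submodule.mul_mem_mul (LinearMap.mem_range_self _ _) hf
      rcases le_or_gt (2 ^ m) y.length with h | h
      · obtain ⟨f, hf, b, hb⟩ := ih y h
        exact ⟨_, hmul x hf, b, by rw [map_mul, hb]; rfl⟩
      · obtain ⟨f, hf, b, hb⟩ := ih x (by rw [pow_succ] at hw; omega)
        exact ⟨_, hmul y hf, b, by rw [map_mul, mul_comm, hb]; rfl⟩

theorem productsVanish_two_pow {m : ℕ} (h : leftMultiplications K A ^ m = ⊥) :
    ProductsVanish A (2 ^ m) := by
  intro w hw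
  obtain ⟨f, hf, b, hb⟩ := exists_mem_leftMultiplications_pow (K := K) m w hw.ge
  rw [h, Submodule.mem_bot] at hf
  rw [hb, hf, LinearMap.zero_apply]

theorem leftMultiplications_pow_eq_bot {G : Type*} {ev : G → A}
    (hev : Submodule.span K (Set.range ev) = ⊤) {m : ℕ}
    (h : ∀ l : List G, l.length = m → (l.map fun p => LinearMap.mulLeft K (ev p)).prod = 0) :
    leftMultiplications K A ^ m = ⊥ := by
  rw [leftMultiplications, LinearMap.range_eq_map, ← hev, Submodule.map_span, ← Set.range_comp]
  exact span_range_pow_eq_bot h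

end Products

section PowerLetters

theorem eq_zero_of_skew_fst_of_not_nodup {K V G E : Type*} [Field K] [AddCommGroup V] [Module K V]
    (h2 : (2 : K) ≠ 0) (f : List (G × E) → V) (l : List (G × E))
    (hf : ∀ u p q a b w, ((u ++ (p, a) :: (q, b) :: w).map Prod.fst).Perm (l.map Prod.fst) →
      (u ++ (p, a) :: (q, b) :: w).map Prod.snd = l.map Prod.snd →
      f (u ++ (p, a) :: (q, b) :: w) + f (u ++ (q, a) :: (p, b) :: w) = 0)
    (hl : ¬ (l.map Prod.fst).Nodup) : f l = 0 := by
  have hzip : (l.map Prod.fst).zip (l.map Prod.snd) = l := by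
    rw [← List.unzip_fst, ← List.unzip_snd, List.zip_unzip]
  rw [← hzip]
  have hlen : (l.map Prod.snd).length = (l.map Prod.fst).length := by simp
  generalize l.map Prod.fst = ps, l.map Prod.snd = es at *
  refine eq_zero_of_skew_of_not_nodup h2 (fun ps => f (ps.zip es)) ps ?_ hl
  intro u p q w hw
  have hes := hlen.trans hw.length_eq.symm
  rw [List.length_append] at hes
  obtain ⟨e₁, e, rfl, he₁, he⟩ : ∃ e₁ e, es = e₁ ++ e ∧ e₁.length = u.length ∧
      e.length = (p :: q :: w).length :=
    ⟨es.take u.length, es.drop u.length, (List.take_append_drop _ _).symm, by simp [hes],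
      by simp [hes]⟩
  obtain ⟨a, b, e₂, rfl, he₂⟩ : ∃ a b e₂, e = a :: b :: e₂ ∧ e₂.length = w.length := by
    match e with
    | a :: b :: e₂ => exact ⟨a, b, e₂, rfl, by simpa using he⟩
  have h := hf (u.zip e₁) p q a b (w.zip e₂)
  simp only [List.map_append, List.map_cons, List.map_fst_zip he₁.ge, List.map_snd_zip he₁.le,
    List.map_fst_zip he₂.ge, List.map_snd_zip he₂.le] at h
  simpa only [List.zip_append he₁.symm, List.zip_cons_cons] using h hw trivial

variable {K G R : Type*} [Field K] [Ring R] [Algebra K R]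

/-- The value of a word in the letters `p x ^ e`, encoded by pairs `(p, e)`, where the letters `p`
take the values `ρ p`. -/
def letterProd (ρ : G → R) (x : R) (l : List (G × ℕ)) : R :=
  (l.map fun a => ρ a.1 * x ^ a.2).prod

/-- The degree of a word in the letters `p x ^ e`, where `x` has degree one. -/
def letterDegree (deg : G → ℕ) (l : List (G × ℕ)) : ℕ := (l.map fun a => deg a.1 + a.2).sum

variable {ρ : G → R} {x : R} {deg : G → ℕ}

theorem letterDegree_eq_of_perm {l l' : List (G × ℕ)}
    (hfst : (l.map Prod.fst).Perm (l'.map Prod.fst)) (hsnd : l.map Prod.snd = l'.map Prod.snd) :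
    letterDegree deg l = letterDegree deg l' := by
  have hsum (l : List (G × ℕ)) :
      letterDegree deg l = ((l.map Prod.fst).map deg).sum + (l.map Prod.snd).sum := by
    rw [letterDegree, List.sum_map_add, List.map_map]; rfl
  rw [hsum, hsum, (hfst.map deg).sum_eq, hsnd]

theorem exists_letterProd_eq_mul_pow (i j : ℕ) (l : List (G × ℕ)) :
    ∃ (i' : ℕ) (l' : List (G × ℕ)), l'.length = l.length ∧
      i' + letterDegree deg l' = i + letterDegree deg l + j ∧
      x ^ i' * letterProd ρ x l' = x ^ i * letterProd ρ x l * x ^ j := by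
  rcases List.eq_nil_or_concat l with rfl | ⟨u, ⟨p, e⟩, rfl⟩
  · exact ⟨i + j, [], rfl, by simp [letterDegree], by simp [letterProd, pow_add]⟩
  · exact ⟨i, u ++ [(p, e + j)], by simp, by simp [letterDegree]; omega,
      by simp [letterProd, pow_add, mul_assoc]⟩

theorem pow_mul_letterProd_add_swap [Mul G] (hdeg : ∀ a b, deg (a * b) = deg a + deg b)
    (hswap : ∀ i p q, ∃ c : K, ρ p * x ^ i * ρ q + ρ q * x ^ i * ρ p
      = c • (x ^ i * ρ (p * q) + ρ (p * q) * x ^ i))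
    {i : ℕ} {u w : List (G × ℕ)} {p q : G} {a b : ℕ}
    (hshort : ∀ i' l', l'.length < (u ++ (p, a) :: (q, b) :: w).length →
      i' + letterDegree deg l' = i + letterDegree deg (u ++ (p, a) :: (q, b) :: w) →
      x ^ i' * letterProd ρ x l' = 0) :
    x ^ i * letterProd ρ x (u ++ (p, a) :: (q, b) :: w)
      + x ^ i * letterProd ρ x (u ++ (q, a) :: (p, b) :: w) = 0 := by
  obtain ⟨i', u', hlen, hdeg', hprod⟩ :=
    exists_letterProd_eq_mul_pow (ρ := ρ) (x := x) (deg := deg) i a u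
  obtain ⟨c, hc⟩ := hswap a p q
  have hleft := hshort i' (u' ++ (p * q, b) :: w) (by simp [hlen])
    (by simp [letterDegree, hdeg] at hdeg' ⊢; omega)
  have hright := hshort i (u ++ (p * q, a + b) :: w) (by simp)
    (by simp [letterDegree, hdeg]; omega)
  have hmul := congrArg (fun t => x ^ i * letterProd ρ x u * t * x ^ b * letterProd ρ x w) hc
  have happ (l w : List (G × ℕ)) : letterProd ρ x (l ++ w) = letterProd ρ x l * letterProd ρ x w :=
    by simp [letterProd]
  have hcons (p : G) (e : ℕ) (l : List (G × ℕ)) :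
      letterProd ρ x ((p, e) :: l) = ρ p * x ^ e * letterProd ρ x l := by simp [letterProd]
  rw [happ, ← mul_assoc, hprod] at hleft
  simp only [happ, hcons, pow_add, mul_add, add_mul, smul_mul_assoc, mul_smul_comm, mul_assoc,
    smul_add] at hleft hright hmul ⊢
  linear_combination (norm := module) hmul + c • hleft + c • hright

variable {T : Finset G} {N : ℕ}

theorem letterDegree_le_of_ne_zero (hx : x ^ 3 = 0) (hT : ∀ p ∉ T, ρ p = 0)
    (hN : ∀ p ∈ T, deg p ≤ N) {i : ℕ} {l : List (G × ℕ)} (h : x ^ i * letterProd ρ x l ≠ 0) :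
    (∀ a ∈ l, a.1 ∈ T) ∧ i + letterDegree deg l ≤ 2 + l.length * (N + 2) := by
  have hpow {e : ℕ} (he : x ^ e ≠ 0) : e ≤ 2 := by
    by_contra! he'
    exact he (pow_eq_zero_of_le he' hx)
  have hletter (a : G × ℕ) (ha : a ∈ l) : ρ a.1 * x ^ a.2 ≠ 0 := fun h0 =>
    right_ne_zero_of_mul h (List.prod_eq_zero (List.mem_map.2 ⟨a, ha, h0⟩))
  have hmem (a : G × ℕ) (ha : a ∈ l) : a.1 ∈ T := by
    by_contra haT
    exact left_ne_zero_of_mul (hletter a ha) (hT _ haT)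
  refine ⟨hmem, Nat.add_le_add (hpow (left_ne_zero_of_mul h)) ?_⟩
  have hsum := List.sum_le_card_nsmul (l.map fun a => deg a.1 + a.2) (N + 2) fun n hn => by
    obtain ⟨a, ha, rfl⟩ := List.mem_map.1 hn
    exact Nat.add_le_add (hN _ (hmem a ha)) (hpow (right_ne_zero_of_mul (hletter a ha)))
  simpa [letterDegree] using hsum

theorem pow_mul_letterProd_eq_zero [Mul G] (h2 : (2 : K) ≠ 0)
    (hdeg : ∀ a b, deg (a * b) = deg a + deg b) (hx : x ^ 3 = 0)
    (hswap : ∀ i p q, ∃ c : K, ρ p * x ^ i * ρ q + ρ q * x ^ i * ρ p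
      = c • (x ^ i * ρ (p * q) + ρ (p * q) * x ^ i))
    (hT : ∀ p ∉ T, ρ p = 0) (hN : ∀ p ∈ T, deg p ≤ N) (i : ℕ) (l : List (G × ℕ))
    (hl : 2 + T.card * (N + 2) < i + letterDegree deg l) : x ^ i * letterProd ρ x l = 0 := by
  classical
  induction hm : l.length using Nat.strong_induction_on generalizing i l with
  | _ m ih =>
    subst hm
    by_contra hne
    obtain ⟨hmem, hle⟩ := letterDegree_le_of_ne_zero hx hT hN hne
    have hcard : T.card < l.length := by
      by_contra! hcard
      have := Nat.mul_le_mul_right (N + 2) hcard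
      omega
    refine hne (eq_zero_of_skew_fst_of_not_nodup h2 (fun l => x ^ i * letterProd ρ x l) l ?_ ?_)
    · intro u p q a b w hfst hsnd
      refine pow_mul_letterProd_add_swap hdeg hswap fun i' l' hlt hl' => ?_
      rw [letterDegree_eq_of_perm hfst hsnd] at hl'
      exact ih _ (by simpa using hlt.trans_eq (by simpa using hfst.length_eq)) i' l' (hl' ▸ hl) rfl
    · intro hnodup
      have hsub : (l.map Prod.fst).toFinset ⊆ T := by
        intro p hp
        obtain ⟨a, ha, rfl⟩ := List.mem_map.1 (List.mem_toFinset.1 hp)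
        exact hmem a ha
      have hle := Finset.card_le_card hsub
      rw [List.toFinset_card_of_nodup hnodup, List.length_map] at hle
      omega

end PowerLetters

section CubeZeroRepresentation

theorem finite_setOf_freeMagma_length_lt {X : Type*} [Finite X] (n : ℕ) :
    {w : FreeMagma X | w.length < n}.Finite := by
  induction n with
  | zero => simp
  | succ n ih =>
    refine ((Set.finite_range FreeMagma.of).union (ih.image2 (· * ·) ih)).subset fun w hw => ?_
    induction w using FreeMagma.recOnMul with
    | ih1 x => exact Or.inl ⟨x, rfl⟩
    | ih2 x y _ _ =>
      change x.length + y.length < n + 1 at hw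
      have := x.length_pos
      have := y.length_pos
      exact Or.inr ⟨x, (by omega : x.length < n), y, (by omega : y.length < n), rfl⟩

/-- The identities satisfied by `ρ`, the left multiplications by the elements of a commutative
algebra with `x ^ 3 = 0`. -/
structure IsCubeZeroRepresentation {G R : Type*} [Mul G] [Ring R] (ρ : G → R) : Prop where
  symmetrized : ∀ a b c, ρ a * ρ b * ρ c + ρ a * ρ c * ρ b + ρ b * ρ a * ρ c + ρ b * ρ c * ρ a
    + ρ c * ρ a * ρ b + ρ c * ρ b * ρ a = 0
  map_mul_eq_neg : ∀ a b, ρ (a * b) = -(ρ a * ρ b + ρ b * ρ a)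

theorem exists_pow_mul_letterProd_eq {R : Type*} [Ring R] {k : ℕ} {σ : Fin (k + 1) → R}
    {ρ : FreeMagma (Fin k) → R} (hρ : ∀ i, ρ (.of i) = σ i.castSucc) (w : List (Fin (k + 1))) :
    ∃ (i : ℕ) (l : List (FreeMagma (Fin k) × ℕ)),
      i + letterDegree FreeMagma.length l = w.length ∧
      σ (Fin.last k) ^ i * letterProd ρ (σ (Fin.last k)) l = (w.map σ).prod := by
  induction w with
  | nil => exact ⟨0, [], rfl, by simp [letterProd]⟩
  | cons j w ih =>
    obtain ⟨i, l, hdeg, hprod⟩ := ih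
    rw [List.map_cons, List.prod_cons, List.length_cons, ← hdeg, ← hprod]
    induction j using Fin.lastCases with
    | last => exact ⟨i + 1, l, by omega, by rw [pow_succ', mul_assoc]⟩
    | cast j =>
      exact ⟨0, (.of j, i) :: l, by simp [letterDegree]; omega,
        by simp [letterProd, hρ, mul_assoc]⟩

namespace IsCubeZeroRepresentation

variable {K G R : Type*} [Field K] [Mul G] [Ring R] {ρ : G → R}

theorem mul_mul_add_swap (hρ : IsCubeZeroRepresentation ρ) (a b c : G) :
    ρ a * ρ c * ρ b + ρ b * ρ c * ρ a = ρ c * ρ (a * b) + ρ (a * b) * ρ c := by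
  simp only [hρ.map_mul_eq_neg, mul_neg, neg_mul, mul_add, add_mul, ← mul_assoc]
  linear_combination (norm := abel) hρ.symmetrized a b c

variable [Algebra K R]

theorem pow_three_eq_zero (hρ : IsCubeZeroRepresentation ρ) (h2 : (2 : K) ≠ 0) (h3 : (3 : K) ≠ 0)
    (a : G) : ρ a ^ 3 = 0 := by
  have h : ((2 : K) * 3) • ρ a ^ 3 = 0 := by
    rw [pow_three, ← mul_assoc]
    linear_combination (norm := module) hρ.symmetrized a a a
  exact (smul_eq_zero_iff_right (mul_ne_zero h2 h3)).1 h

theorem exists_mul_pow_mul_add_swap (hρ : IsCubeZeroRepresentation ρ) (h2 : (2 : K) ≠ 0)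
    (h3 : (3 : K) ≠ 0) (y : G) (i : ℕ) (a b : G) :
    ∃ c : K, ρ a * ρ y ^ i * ρ b + ρ b * ρ y ^ i * ρ a
      = c • (ρ y ^ i * ρ (a * b) + ρ (a * b) * ρ y ^ i) := by
  match i with
  | 0 =>
    refine ⟨-(1 / 2), ?_⟩
    rw [pow_zero, mul_one, mul_one, one_mul, mul_one, hρ.map_mul_eq_neg, ← two_smul K, smul_smul,
      neg_mul, one_div_mul_cancel h2, smul_neg, neg_smul, one_smul, neg_neg]
  | 1 => exact ⟨1, by rw [pow_one, one_smul, hρ.mul_mul_add_swap]⟩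
  | 2 =>
    have h := hρ.mul_mul_add_swap a b (y * y)
    rw [hρ.map_mul_eq_neg y y, ← two_smul K, ← sq] at h
    simp only [mul_neg, neg_mul, mul_smul_comm, smul_mul_assoc] at h
    refine ⟨1, sub_eq_zero.1 ((smul_eq_zero_iff_right h2).1 ?_)⟩
    linear_combination (norm := module) -h
  | i + 3 => exact ⟨0, by simp [pow_add, hρ.pow_three_eq_zero h2 h3]⟩

variable (K) in
theorem map_lift_mem_span_pow (hρ : IsCubeZeroRepresentation ρ) {X : Type*} (g : X → G)
    (p : FreeMagma X) :
    ρ (FreeMagma.lift g p) ∈ Submodule.span K (Set.range fun i => ρ (g i)) ^ p.length := by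
  induction p using FreeMagma.recOnMul with
  | ih1 i => exact (pow_one (Submodule.span K _)).ge (Submodule.subset_span ⟨i, rfl⟩)
  | ih2 p q hp hq =>
    change _ ∈ _ ^ (p.length + q.length)
    rw [map_mul, hρ.map_mul_eq_neg, pow_add]
    refine neg_mem (add_mem (Submodule.mul_mem_mul hp hq) ?_)
    rw [pow_mul_comm]
    exact Submodule.mul_mem_mul hq hp

theorem map_lift_eq_zero (hρ : IsCubeZeroRepresentation ρ) {X : Type*} {g : X → G} {N : ℕ}
    (hN : Submodule.span K (Set.range fun i => ρ (g i)) ^ N = ⊥) {p : FreeMagma X}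
    (hp : N ≤ p.length) : ρ (FreeMagma.lift g p) = 0 := by
  have h := hρ.map_lift_mem_span_pow K g p
  rwa [pow_eq_zero_of_le hp hN] at h

theorem exists_span_pow_eq_bot (hρ : IsCubeZeroRepresentation ρ) (h2 : (2 : K) ≠ 0)
    (h3 : (3 : K) ≠ 0) {k : ℕ} (g : Fin k → G) :
    ∃ N, Submodule.span K (Set.range fun i => ρ (g i)) ^ N = ⊥ := by
  induction k with
  | zero => exact ⟨1, by simp⟩
  | succ k ih =>
    let g' : Fin k → G := fun i => g i.castSucc
    obtain ⟨N, hN⟩ := ih g'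
    let T := (finite_setOf_freeMagma_length_lt (X := Fin k) N).toFinset
    have hT (p : FreeMagma (Fin k)) : p ∈ T ↔ p.length < N := by simp [T]
    refine ⟨2 + T.card * (N + 2) + 1, span_range_pow_eq_bot fun w hw => ?_⟩
    obtain ⟨i, l, hdeg, hprod⟩ := exists_pow_mul_letterProd_eq (σ := fun i => ρ (g i))
      (ρ := fun p => ρ (FreeMagma.lift g' p)) (fun _ => rfl) w
    rw [← hprod]
    refine pow_mul_letterProd_eq_zero h2 (fun _ _ => rfl) (hρ.pow_three_eq_zero h2 h3 _)
      (fun i p q => ?_) (fun p hp => hρ.map_lift_eq_zero hN (by simpa [hT] using hp))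
      (fun p hp => ((hT p).1 hp).le) i l (by omega)
    rw [map_mul]
    exact hρ.exists_mul_pow_mul_add_swap h2 h3 _ i _ _

theorem exists_prod_map_lift_eq_zero (hρ : IsCubeZeroRepresentation ρ) (h2 : (2 : K) ≠ 0)
    (h3 : (3 : K) ≠ 0) {k : ℕ} (g : Fin k → G) :
    ∃ N, ∀ l : List (FreeMagma (Fin k)), l.length = N →
      (l.map fun p => ρ (FreeMagma.lift g p)).prod = 0 := by
  obtain ⟨N, hN⟩ := hρ.exists_span_pow_eq_bot h2 h3 g
  have hprod (l : List (FreeMagma (Fin k))) :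
      (l.map fun p => ρ (FreeMagma.lift g p)).prod
        ∈ Submodule.span K (Set.range fun i => ρ (g i)) ^ (l.map FreeMagma.length).sum := by
    induction l with
    | nil => exact Submodule.one_le.1 (pow_zero _).ge
    | cons p l ih =>
      rw [List.map_cons, List.map_cons, List.prod_cons, List.sum_cons, pow_add]
      exact Submodule.mul_mem_mul (hρ.map_lift_mem_span_pow K g p) ih
  refine ⟨N, fun l hl => ?_⟩
  have hle : l.length ≤ (l.map FreeMagma.length).sum := by
    simpa using List.length_le_sum_of_one_le (l.map FreeMagma.length)
      (by simpa using fun p _ => p.length_pos)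
  have h := hprod l
  rwa [pow_eq_zero_of_le (hl ▸ hle) hN] at h

end IsCubeZeroRepresentation

end CubeZeroRepresentation

section Monomials

variable {X : Type v}

namespace CommMonomial

/-- The monomial of degree one given by a letter. -/
def of (x : X) : CommMonomial X := (FreeMagma.of x : FreeMagma X)

theorem degree_of (x : X) : (of x).degree = 1 := rfl

theorem degree_mul (p q : CommMonomial X) : (p * q).degree = p.degree + q.degree := by
  induction p, q using Con.induction_on₂ with
  | H a b => rfl

theorem degree_pos (p : CommMonomial X) : 0 < p.degree := by
  induction p using Con.induction_on with
  | H a => exact a.length_pos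

theorem mul_ne_of (p q : CommMonomial X) (x : X) : p * q ≠ of x := fun h => by
  have hdeg := congrArg degree h
  rw [degree_mul, degree_of] at hdeg
  have := p.degree_pos
  have := q.degree_pos
  omega

/-- The value of a commutative monomial in a commutative magma. -/
def lift {M : Type*} [CommMagma M] (g : X → M) : CommMonomial X →ₙ* M where
  toFun p := Con.liftOn p (FreeMagma.lift g) fun _ _ h => by
    refine (Con.conGen_le (c := Con.ker (FreeMagma.lift g))).2 ?_ h
    rintro _ _ ⟨a, b, rfl, rfl⟩
    rw [Con.ker_rel, map_mul, map_mul, mul_comm]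
  map_mul' p q := by
    induction p, q using Con.induction_on₂ with
    | H a b => exact map_mul (FreeMagma.lift g) a b

theorem lift_of {M : Type*} [CommMagma M] (g : X → M) (x : X) : lift g (of x) = g x := rfl

theorem finite_setOf_degree_lt [Finite X] (n : ℕ) : {p : CommMonomial X | p.degree < n}.Finite := by
  refine ((finite_setOf_freeMagma_length_lt n).image ((↑) : FreeMagma X → _)).subset fun p hp => ?_
  induction p using Con.induction_on with
  | H a => exact ⟨a, hp, rfl⟩

/-- The finite set of monomials of degree less than `n` in finitely many letters; its cardinality
is `dim[n,k]`. -/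
noncomputable def degreeLT (X : Type v) [Finite X] (n : ℕ) : Finset (CommMonomial X) :=
  (finite_setOf_degree_lt n).toFinset

theorem mem_degreeLT [Finite X] {n : ℕ} {p : CommMonomial X} :
    p ∈ degreeLT X n ↔ p.degree < n := by
  simp [degreeLT]

end CommMonomial

theorem dimBelow_eq_card (K : Type u) [Field K] (n k : ℕ) :
    dimBelow K n k = (CommMonomial.degreeLT (Fin k) n).card := by
  have hli := (MonoidAlgebra.basis (CommMonomial (Fin k)) K).linearIndependent.comp
    (Subtype.val : CommMonomial.degreeLT (Fin k) n → _) Subtype.val_injective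
  rw [dimBelow, ← Fintype.card_coe, ← finrank_span_eq_card hli]
  refine congrArg (fun s => Module.finrank K (Submodule.span K s)) (Set.ext fun f => ?_)
  simp [CommMonomial.mem_degreeLT, eq_comm]

variable {K : Type u} [Field K]

theorem cube_mem_cubeIdeal (a : FreeCommAlg K X) : a * (a * a) ∈ cubeIdeal K X := by
  rw [cubeIdeal, Submodule.mem_sInf]
  exact fun N hN => hN.1 a

theorem cubeIdeal_le {N : Submodule K (FreeCommAlg K X)} (hcube : ∀ a, a * (a * a) ∈ N)
    (hmul : ∀ a, ∀ b ∈ N, a * b ∈ N) : cubeIdeal K X ≤ N :=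
  sInf_le ⟨hcube, hmul⟩

theorem coeff_mul_of_eq_zero (a b : FreeCommAlg K X) (x : X) :
    (a * b).coeff (CommMonomial.of x) = 0 := by
  classical
  simp [MonoidAlgebra.coeff_mul, CommMonomial.mul_ne_of]

theorem single_of_notMem_cubeIdeal (x : X) :
    (MonoidAlgebra.single (CommMonomial.of x) 1 : FreeCommAlg K X) ∉ cubeIdeal K X := by
  have hle : cubeIdeal K X ≤ LinearMap.ker
      (Finsupp.lapply (CommMonomial.of x) ∘ₗ (MonoidAlgebra.coeffLinearEquiv K).toLinearMap) :=
    cubeIdeal_le (fun a => coeff_mul_of_eq_zero a _ x) fun a b _ => coeff_mul_of_eq_zero a b x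
  intro h
  have hcoeff : (MonoidAlgebra.single (CommMonomial.of x) (1 : K)).coeff (CommMonomial.of x) = 0 :=
    hle h
  simp at hcoeff

namespace FreeCubeZeroAlg

variable (K) in
/-- The generators of the free algebra with `x ^ 3 = 0`. -/
noncomputable def gen (x : X) : FreeCubeZeroAlg K X :=
  Submodule.Quotient.mk (MonoidAlgebra.single (CommMonomial.of x) 1)

theorem lift_gen (w : FreeMagma X) :
    FreeMagma.lift (gen K) w
      = Submodule.Quotient.mk (MonoidAlgebra.single (w : CommMonomial X) 1) := by
  induction w using FreeMagma.recOnMul with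
  | ih1 x => rfl
  | ih2 x y hx hy =>
    rw [map_mul, hx, hy, Con.coe_mul, ← mul_one (1 : K), ← MonoidAlgebra.single_mul_single, mul_one]
    rfl

theorem gen_ne_zero (x : X) : gen K x ≠ 0 := fun h =>
  single_of_notMem_cubeIdeal x ((Submodule.Quotient.mk_eq_zero _).1 h)

instance : IsScalarTower K (FreeCubeZeroAlg K X) (FreeCubeZeroAlg K X) where
  smul_assoc := by
    rintro t ⟨a⟩ ⟨b⟩
    exact congrArg (Submodule.Quotient.mk (p := cubeIdeal K X)) (smul_mul_assoc t a b)

instance : SMulCommClass K (FreeCubeZeroAlg K X) (FreeCubeZeroAlg K X) where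
  smul_comm := by
    rintro t ⟨a⟩ ⟨b⟩
    exact congrArg (Submodule.Quotient.mk (p := cubeIdeal K X)) (mul_smul_comm t a b).symm

theorem isGeneratedBy (k : ℕ) : IsGeneratedBy K (FreeCubeZeroAlg K (Fin k)) k := by
  refine ⟨gen K, eq_top_iff.2 ?_⟩
  have hlift (w : FreeMagma (Fin k)) :
      FreeMagma.lift (gen K) w ∈ NonUnitalAlgebra.adjoin K (Set.range (gen K)) := by
    induction w using FreeMagma.recOnMul with
    | ih1 x => exact NonUnitalAlgebra.subset_adjoin K ⟨x, rfl⟩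
    | ih2 x y hx hy => exact map_mul (FreeMagma.lift (gen K)) x y ▸ mul_mem hx hy
  rintro ⟨f⟩ -
  change Submodule.Quotient.mk f ∈ _
  induction f using MonoidAlgebra.induction_linear with
  | zero => exact zero_mem _
  | add f g hf hg => exact add_mem hf hg
  | single p r =>
    induction p using Con.induction_on with
    | H w =>
      rw [← mul_one r, ← smul_eq_mul, ← MonoidAlgebra.smul_single, Submodule.Quotient.mk_smul,
        ← lift_gen]
      exact SMulMemClass.smul_mem r (hlift w)

theorem cube_eq_zero (a : FreeCubeZeroAlg K X) : a * (a * a) = 0 := by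
  obtain ⟨a⟩ := a
  exact (Submodule.Quotient.mk_eq_zero _).2 (cube_mem_cubeIdeal a)

end FreeCubeZeroAlg

theorem HasNilpotencyIndex.two_le {n : ℕ} (h : HasNilpotencyIndex (FreeCubeZeroAlg K X) n)
    (x : X) : 2 ≤ n := by
  obtain ⟨⟨hn, hv⟩, -⟩ := h
  by_contra! hlt
  obtain rfl : n = 1 := by omega
  exact FreeCubeZeroAlg.gen_ne_zero x (hv (.of (FreeCubeZeroAlg.gen K x)) rfl)

theorem ProductsVanish.single_mem_cubeIdeal {n : ℕ} (h : ProductsVanish (FreeCubeZeroAlg K X) n)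
    (hn : 1 ≤ n) {p : CommMonomial X} (hp : n ≤ p.degree) :
    (MonoidAlgebra.single p 1 : FreeCommAlg K X) ∈ cubeIdeal K X := by
  induction p using Con.induction_on with
  | H w =>
    rw [← Submodule.Quotient.mk_eq_zero, ← FreeCubeZeroAlg.lift_gen]
    exact h.lift_eq_zero hn _ hp

end Monomials

section Nilpotency

variable {K : Type u} [Field K] {A : Type v} [NonUnitalNonAssocCommRing A] [Module K A]

theorem cubeForm_eq_zero (h2 : (2 : K) ≠ 0) (hA : ∀ x : A, x * (x * x) = 0) (a b c : A) :
    cubeForm a b c = 0 := by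
  have hbot : cubeSpan K A = ⊥ := by
    rw [cubeSpan, Submodule.span_eq_bot]
    exact Set.forall_mem_range.2 hA
  exact (Submodule.mem_bot K).1 (hbot ▸ cubeForm_mem_cubeSpan h2 a b c)

variable [SMulCommClass K A A]

theorem isCubeZeroRepresentation_mulLeft (h2 : (2 : K) ≠ 0) (hA : ∀ x : A, x * (x * x) = 0) :
    IsCubeZeroRepresentation (LinearMap.mulLeft K : A → Module.End K A) := by
  have hmul (a b : A) : LinearMap.mulLeft K (a * b)
      = -(LinearMap.mulLeft K a * LinearMap.mulLeft K b
        + LinearMap.mulLeft K b * LinearMap.mulLeft K a) := by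
    ext v
    have h := cubeForm_eq_zero h2 hA a b v
    rw [cubeForm, mul_comm v] at h
    simp only [LinearMap.mulLeft_apply, LinearMap.neg_apply, LinearMap.add_apply,
      Module.End.mul_apply]
    linear_combination (norm := abel) h
  refine ⟨fun a b c => (smul_eq_zero_iff_right h2).1 ?_, hmul⟩
  have h : LinearMap.mulLeft K (a * (b * c)) + LinearMap.mulLeft K (b * (a * c))
      + LinearMap.mulLeft K (c * (a * b)) = 0 := by
    ext v
    simpa only [LinearMap.add_apply, LinearMap.mulLeft_apply, LinearMap.zero_apply, cubeForm,
      add_mul, zero_mul] using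
      congrArg (· * v) (cubeForm_eq_zero h2 hA a b c)
  simp only [hmul, mul_neg, neg_mul, mul_add, add_mul, ← mul_assoc] at h
  linear_combination (norm := module) h

theorem SatisfiesCubicIdentity.subalgebra {γ : K} (hA : SatisfiesCubicIdentity K A γ)
    (S : NonUnitalSubalgebra K A) : SatisfiesCubicIdentity K S γ := fun x =>
  LinearMap.ext fun v => Subtype.ext (hA.apply (x : A) v)

theorem exists_prod_map_mulLeft_apply_eq {X : Type*} (ev : CommMonomial X →ₙ* A)
    (l : List (CommMonomial X)) (p : CommMonomial X) :
    ∃ q : CommMonomial X, (l.map fun r => LinearMap.mulLeft K (ev r)).prod (ev p) = ev q ∧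
      l.length < q.degree := by
  induction l with
  | nil => exact ⟨p, rfl, p.degree_pos⟩
  | cons r l ih =>
    obtain ⟨q, hq, hdeg⟩ := ih
    refine ⟨r * q, by simp [hq], ?_⟩
    have := r.degree_pos
    rw [CommMonomial.degree_mul, List.length_cons]
    omega

theorem prod_map_mulLeft_apply_mem_cubeSpan {X : Type*} {ev : CommMonomial X →ₙ* A}
    (hspan : Submodule.span K (Set.range ev) = ⊤) {n : ℕ}
    (hev : ∀ p, n ≤ p.degree → ev p ∈ cubeSpan K A) {l : List (CommMonomial X)}
    (hl : n ≤ l.length + 1) (a : A) :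
    (l.map fun r => LinearMap.mulLeft K (ev r)).prod a ∈ cubeSpan K A := by
  have hle : Submodule.span K (Set.range ev)
      ≤ (cubeSpan K A).comap (l.map fun r => LinearMap.mulLeft K (ev r)).prod := by
    refine Submodule.span_le.2 (Set.range_subset_iff.2 fun p => ?_)
    obtain ⟨q, hq, hdeg⟩ := exists_prod_map_mulLeft_apply_eq (K := K) ev l p
    exact (congrArg (· ∈ cubeSpan K A) hq).mpr (hev q (by omega))
  exact hle (hspan ▸ Submodule.mem_top)

variable [IsScalarTower K A A]

theorem span_range_eq_top_of_adjoin_eq_top {G X : Type*} [Mul G] {ev : G →ₙ* A} {g : X → A}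
    (hg : NonUnitalAlgebra.adjoin K (Set.range g) = ⊤) (hev : Set.range g ⊆ Set.range ev) :
    Submodule.span K (Set.range ev) = ⊤ := by
  rw [eq_top_iff, ← NonUnitalAlgebra.top_toSubmodule, ← hg, NonUnitalAlgebra.adjoin_eq_span]
  exact Submodule.span_mono (Subsemigroup.closure_le (S := ev.srange).2 hev)

theorem IsGeneratedBy.exists_productsVanish {k : ℕ} (hg : IsGeneratedBy K A k) (h2 : (2 : K) ≠ 0)
    (h3 : (3 : K) ≠ 0) (hA : ∀ x : A, x * (x * x) = 0) : ∃ N, 0 < N ∧ ProductsVanish A N := by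
  obtain ⟨g, hg⟩ := hg
  obtain ⟨N, hN⟩ :=
    (isCubeZeroRepresentation_mulLeft h2 hA).exists_prod_map_lift_eq_zero h2 h3 g
  have hspan := span_range_eq_top_of_adjoin_eq_top (ev := FreeMagma.lift g) hg
    (Set.range_subset_iff.2 fun i => ⟨.of i, rfl⟩)
  exact ⟨2 ^ N, by positivity, productsVanish_two_pow (leftMultiplications_pow_eq_bot hspan hN)⟩

theorem nilpotency_exponent_le {n d : ℕ} (hn : 2 ≤ n) (hd : 1 ≤ d) :
    (d + 2) * (n - 1) + 1 + (n - 1) ≤ 4 * n * d + 2 * (n - 2) := by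
  obtain ⟨n, rfl⟩ := Nat.exists_eq_add_of_le' hn
  obtain ⟨d, rfl⟩ := Nat.exists_eq_add_of_le' hd
  rw [Nat.add_sub_cancel, show n + 2 - 1 = n + 1 from rfl]
  nlinarith [Nat.zero_le (d * n)]

namespace SatisfiesCubicIdentity

variable {γ : K}

theorem lift_mem_cubeSpan (hA : SatisfiesCubicIdentity K A γ) (h2 : (2 : K) ≠ 0)
    (h3 : (3 : K) ≠ 0) (hγ : γ ≠ -1) (hγ0 : γ ≠ 0) {X : Type*} {n : ℕ}
    (hv : ProductsVanish (FreeCubeZeroAlg K X) n) (hn : 1 ≤ n) (g : X → A) {p : CommMonomial X}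
    (hp : n ≤ p.degree) : CommMonomial.lift g p ∈ cubeSpan K A := by
  let φ := MonoidAlgebra.liftMagma K (CommMonomial.lift g)
  have hle : cubeIdeal K X ≤ (cubeSpan K A).comap (φ : FreeCommAlg K X →ₗ[K] A) := by
    refine cubeIdeal_le (fun a => ?_) (fun a b hb => ?_)
    · change φ (a * (a * a)) ∈ cubeSpan K A
      rw [map_mul, map_mul]
      exact cube_mem_cubeSpan _
    · change φ (a * b) ∈ cubeSpan K A
      rw [map_mul]
      exact hA.mul_mem_cubeSpan h2 h3 hγ hγ0 _ hb
  have h : φ (MonoidAlgebra.single p 1) ∈ cubeSpan K A := hle (hv.single_mem_cubeIdeal hn hp)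
  simpa [φ] using h

theorem prod_map_mulLeft_eq_zero (hA : SatisfiesCubicIdentity K A γ) (h2 : (2 : K) ≠ 0)
    (h3 : (3 : K) ≠ 0) (hγ : γ ≠ -1) (hγ0 : γ ≠ 0) (hγ2 : γ ≠ 1 / 2) (hγ2' : γ ≠ -(1 / 2))
    {X : Type*} [Finite X] {ev : CommMonomial X →ₙ* A}
    (hspan : Submodule.span K (Set.range ev) = ⊤) {n : ℕ}
    (hev : ∀ p, n ≤ p.degree → ev p ∈ cubeSpan K A) {l : List (CommMonomial X)}
    (hl : ((CommMonomial.degreeLT X n).card + 2) * (n - 1) + 1 + (n - 1) ≤ l.length) :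
    (l.map fun p => LinearMap.mulLeft K (ev p)).prod = 0 := by
  ext a
  rw [← List.take_append_drop (l.length - (n - 1)) l, List.map_append, List.prod_append,
    Module.End.mul_apply, LinearMap.zero_apply]
  refine hA.prod_map_mulLeft_apply_eq_zero h2 h3 hγ hγ0 hγ2 hγ2' CommMonomial.degree_mul ev
    (T := CommMonomial.degreeLT X n) (N := n - 1) (fun p hp => hev p ?_) (fun p hp => ?_) _ ?_
    (prod_map_mulLeft_apply_mem_cubeSpan hspan hev ?_ a)
  · rwa [CommMonomial.mem_degreeLT, not_lt] at hp
  · exact Nat.le_pred_of_lt (CommMonomial.mem_degreeLT.1 hp)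
  · have hle := List.length_le_sum_of_one_le
      ((l.take (l.length - (n - 1))).map CommMonomial.degree)
      (List.forall_mem_map.2 fun p _ => p.degree_pos)
    rw [List.length_map, List.length_take] at hle
    omega
  · rw [List.length_drop]
    omega

theorem exists_hasNilpotencyIndex_le (hA : SatisfiesCubicIdentity K A γ) (h2 : (2 : K) ≠ 0)
    (h3 : (3 : K) ≠ 0) (hγ : γ ≠ -1) (hγ0 : γ ≠ 0) (hγ2 : γ ≠ 1 / 2) (hγ2' : γ ≠ -(1 / 2))
    {k : ℕ} (hk : 1 ≤ k) {n : ℕ} (hn : HasNilpotencyIndex (FreeCubeZeroAlg K (Fin k)) n)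
    (hg : IsGeneratedBy K A k) :
    ∃ m : ℕ, HasNilpotencyIndex A m ∧ m ≤ 2 ^ (4 * n * dimBelow K n k + 2 * (n - 2)) := by
  obtain ⟨g, hg⟩ := hg
  have hn2 := hn.two_le ⟨0, hk⟩
  have hd : 1 ≤ (CommMonomial.degreeLT (Fin k) n).card :=
    Finset.card_pos.2 ⟨CommMonomial.of ⟨0, hk⟩, CommMonomial.mem_degreeLT.2 hn2⟩
  have hspan := span_range_eq_top_of_adjoin_eq_top (ev := CommMonomial.lift g) hg
    (Set.range_subset_iff.2 fun i => ⟨.of i, CommMonomial.lift_of g i⟩)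
  rw [dimBelow_eq_card]
  refine (productsVanish_two_pow (K := K) (leftMultiplications_pow_eq_bot hspan fun l hl => ?_)
    ).exists_hasNilpotencyIndex_le (by positivity)
  exact hA.prod_map_mulLeft_eq_zero h2 h3 hγ hγ0 hγ2 hγ2' hspan
    (fun p => hA.lift_mem_cubeSpan h2 h3 hγ hγ0 hn.1.2 hn.1.1 g)
    ((nilpotency_exponent_le hn2 hd).trans_eq hl.symm)

end SatisfiesCubicIdentity

-- The extra generator `0` makes the number of generators positive.
theorem isGeneratedBy_adjoin (s : Finset A) :
    IsGeneratedBy K (NonUnitalAlgebra.adjoin K (s : Set A)) (s.card + 1) := by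
  let e := s.equivFin
  let g (i : Fin (s.card + 1)) : NonUnitalAlgebra.adjoin K (s : Set A) :=
    Fin.lastCases 0 (fun j => ⟨e.symm j, NonUnitalAlgebra.subset_adjoin K (e.symm j).2⟩) i
  refine ⟨g, eq_top_iff.2 ?_⟩
  rintro ⟨a, ha⟩ -
  induction ha using NonUnitalAlgebra.adjoin_induction with
  | mem x hx =>
    refine NonUnitalAlgebra.subset_adjoin K ⟨(e ⟨x, hx⟩).castSucc, ?_⟩
    simp [g]
  | add x y _ _ hx hy => exact add_mem hx hy
  | zero => exact zero_mem _
  | mul x y _ _ hx hy => exact mul_mem hx hy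
  | smul r x _ hx => exact SMulMemClass.smul_mem r hx

theorem exists_hasNilpotencyIndex_freeCubeZeroAlg (h2 : (2 : K) ≠ 0) (h3 : (3 : K) ≠ 0) (k : ℕ) :
    ∃ n, HasNilpotencyIndex (FreeCubeZeroAlg K (Fin k)) n := by
  obtain ⟨N, hN, hv⟩ :=
    (FreeCubeZeroAlg.isGeneratedBy k).exists_productsVanish h2 h3 FreeCubeZeroAlg.cube_eq_zero
  obtain ⟨n, hn, -⟩ := hv.exists_hasNilpotencyIndex_le hN
  exact ⟨n, hn⟩

theorem SatisfiesCubicIdentity.isLocallyNilpotentAlgebra {γ : K}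
    (hA : SatisfiesCubicIdentity K A γ) (h2 : (2 : K) ≠ 0) (h3 : (3 : K) ≠ 0) (hγ : γ ≠ -1)
    (hγ0 : γ ≠ 0) (hγ2 : γ ≠ 1 / 2) (hγ2' : γ ≠ -(1 / 2)) : IsLocallyNilpotentAlgebra K A := by
  intro s
  obtain ⟨n, hn⟩ := exists_hasNilpotencyIndex_freeCubeZeroAlg h2 h3 (s.card + 1)
  obtain ⟨m, hm, -⟩ := (hA.subalgebra _).exists_hasNilpotencyIndex_le h2 h3 hγ hγ0 hγ2 hγ2'
    (Nat.le_add_left 1 _) hn (isGeneratedBy_adjoin s)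
  exact ⟨m, hm.1⟩

theorem three_ne_zero_of_ringChar_ne_three (h : ringChar K ≠ 3) : (3 : K) ≠ 0 := fun h0 =>
  h (CharP.ringChar_of_prime_eq_zero Nat.prime_three (by exact_mod_cast h0))

end Nilpotency

theorem theorem3_general {K : Type u} [Field K] (h2 : ringChar K ≠ 2) (h3 : ringChar K ≠ 3)
    (γ : K) (hγ0 : γ ≠ 0) (hγ1' : γ ≠ -1) (hγ2 : γ ≠ 1 / 2) (hγ2' : γ ≠ -(1 / 2)) :
    (∀ (A : Type v) [NonUnitalNonAssocCommRing A] [Module K A] [IsScalarTower K A A]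
        [SMulCommClass K A A],
      SatisfiesCubicIdentity K A γ → IsLocallyNilpotentAlgebra K A) ∧
    (∀ k : ℕ, 1 ≤ k →
      ∃ n : ℕ, HasNilpotencyIndex (FreeCubeZeroAlg K (Fin k)) n ∧
        ∀ (A : Type v) [NonUnitalNonAssocCommRing A] [Module K A] [IsScalarTower K A A]
          [SMulCommClass K A A],
          SatisfiesCubicIdentity K A γ → IsGeneratedBy K A k →
            ∃ m : ℕ, HasNilpotencyIndex A m ∧
              m ≤ 2 ^ (4 * n * dimBelow K n k + 2 * (n - 2))) := by
  have h2 : (2 : K) ≠ 0 := Ring.two_ne_zero h2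
  have h3 : (3 : K) ≠ 0 := three_ne_zero_of_ringChar_ne_three h3
  refine ⟨fun A _ _ _ _ hA => hA.isLocallyNilpotentAlgebra h2 h3 hγ1' hγ0 hγ2 hγ2',
    fun k hk => ?_⟩
  obtain ⟨n, hn⟩ := exists_hasNilpotencyIndex_freeCubeZeroAlg h2 h3 k
  exact ⟨n, hn, fun A _ _ _ _ hA hg =>
    hA.exists_hasNilpotencyIndex_le h2 h3 hγ1' hγ0 hγ2 hγ2' hk hn hg⟩

theorem theorem3 {K : Type u} [Field K] (h2 : ringChar K ≠ 2) (h3 : ringChar K ≠ 3)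
    (γ : K) (hγ0 : γ ≠ 0) (hγ1 : γ ≠ 1) (hγ1' : γ ≠ -1)
    (hγ2 : γ ≠ 1 / 2) (hγ2' : γ ≠ -(1 / 2)) :
    (∀ (A : Type v) [NonUnitalNonAssocCommRing A] [Module K A] [IsScalarTower K A A]
        [SMulCommClass K A A],
      SatisfiesCubicIdentity K A γ → IsLocallyNilpotentAlgebra K A) ∧
    (∀ k : ℕ, 1 ≤ k →
      ∃ n : ℕ, HasNilpotencyIndex (FreeCubeZeroAlg K (Fin k)) n ∧
        ∀ (A : Type v) [NonUnitalNonAssocCommRing A] [Module K A] [IsScalarTower K A A]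
          [SMulCommClass K A A],
          SatisfiesCubicIdentity K A γ → IsGeneratedBy K A k →
            ∃ m : ℕ, HasNilpotencyIndex A m ∧
              m ≤ 2 ^ (4 * n * dimBelow K n k + 2 * (n - 2))) := by
  exact theorem3_general h2 h3 γ hγ0 hγ1' hγ2 hγ2'
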